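/- For a real matrix $X$ let $\sigma_1(X)\ge\sigma_2(X)\ge\cdots$ be its singular values, and let the volume of a $p\times q$ matrix be ${\rm vol}(X)=\prod_{j=1}^{\min(p,q)}\sigma_j(X)$. A $p\times q$ submatrix $B$ of $A\in\mathbb{R}^{m\times n}$ is a *local maximum volume submatrix* if ${\rm vol}(B)>0$ and ${\rm vol}(B)\ge {\rm vol}(\hat B)$ for all $p\times q$ submatrices $\hat B$ of $A$ that differ from $B$ in at most one row and at most one column. Given permutation matrices $P_1,P_2$, write $$P_1AP_2=\begin{bmatrix}A_{11}&A_{12}\\A_{21}&A_{22}\end{bmatrix},\quad A_{11}\in\mathbb{R}^{k\times k},\qquad A_k=P_1^{-1}\begin{bmatrix}A_{11}&A_{12}\\A_{21}&A_{21}A_{11}^{-1}A_{12}\end{bmatrix}P_2^{-1}.$$ *Gaussian elimination (GE) with local maximum volume pivoting* chooses $P_1,P_2$ so that $A_{11}$ is a $k\times k$ local maximum volume submatrix of $A$ (any such choice is allowed) and returns $A_k$. If ${\rm rank}(A)<k$, so that no $k\times k$ pivot exists, elimination stops after a local maximum volume pivot of size $r={\rm rank}(A)$ and returns $A_r$, which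 is taken as $A_k$. A method that returns an $m \times n$ matrix $A_k$ for an input $(A,k)$ is a *rank-revealer with factor* $\mu_{m,n,k}\ge 1$, where $\mu_{m,n,k}$ is bounded by a polynomial in $m,n,k$, if for every $m,n$, every $A\in\mathbb{R}^{m\times n}$ and every $1\le k\le\min(m,n)$ it returns a matrix, and every matrix $A_k$ that it may return has rank at most $k$ and satisfies $$\frac{1}{\mu_{m,n,k}}\sigma_j(A)\le\sigma_j(A_k)\le\mu_{m,n,k}\,\sigma_j(A),\qquad 1\le j\le k,$$ $$\frac{1}{\mu_{m,n,k}}\sigma_{k+j}(A)\le\sigma_j(A-A_k)\le\mu_{m,n,k}\,\sigma_{k+j}(A),\qquad 1\le j\le\min(m,n)-k.$$ **Theorem.** GE with local maximum volume pivoting is a rank-revealer with factor $\mu_{m,n,k}=1+5k\sqrt{mn}$. Moreover, for every local maximum volume pivot $A_{11}$ (of any size $k$), it computes the partial LU factorization $$P_1AP_2=\begin{bmatrix}I&0\\A_{21}A_{11}^{-1}&I\end{bmatrix}\begin{bmatrix}A_{11}&A_{12}\\0&S(A_{11})\end{bmatrix},\qquad S(A_{11})=A_{22}-A_{21}A_{11}^{-1}A_{12},$$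 and this factorization satisfies interpolative bounds with some $0\le\nu\le1$: all entries of $A_{21}A_{11}^{-1}$ and of $A_{11}^{-1}A_{12}$ are at most $\nu$ in absolute value. -/

import Mathlib

namespace RankRevealing

/-- The `j`-th singular value `σ_j(A)` of a real matrix, numbered from `1` in nonincreasing order
and followed by zeros (Mathlib numbers the singular values from `0`; only `j ≥ 1` is used). -/
noncomputable def sigma {ι κ : Type*} [Fintype ι] [Fintype κ] [DecidableEq κ]
    (A : Matrix ι κ ℝ) (j : ℕ) : ℝ :=
  (Matrix.toEuclideanLin A).singularValues (j - 1)

/-- The volume of a matrix: the product of its `min(p,q)` singular values. -/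
noncomputable def vol {p q : ℕ} (B : Matrix (Fin p) (Fin q) ℝ) : ℝ :=
  ∏ j ∈ Finset.Icc 1 (min p q), sigma B j

/-- The `p × q` submatrix of `A` with (distinct) row indices `r` and column indices `c` is a local
maximum volume submatrix: its volume is positive and at least the volume of every `p × q` submatrix
whose set of row indices differs from that of `r` by at most one replacement, and likewise for the
columns. -/
def IsLocalMaxVolume {m n p q : ℕ} (A : Matrix (Fin m) (Fin n) ℝ)
    (r : Fin p ↪ Fin m) (c : Fin q ↪ Fin n) : Prop :=
  0 < vol (A.submatrix r c) ∧
    ∀ (r' : Fin p ↪ Fin m) (c' : Fin q ↪ Fin n),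
      (Finset.univ.map r \ Finset.univ.map r').card ≤ 1 →
      (Finset.univ.map c \ Finset.univ.map c').card ≤ 1 →
      vol (A.submatrix r' c') ≤ vol (A.submatrix r c)

/-- A pair of permutations `P₁`, `P₂` of the rows and columns of an `m × n` matrix, together with
the splitting of the permuted indices into the first `k` and the remaining ones. -/
structure Pivoting (m n k : ℕ) where
  row : Fin k ⊕ Fin (m - k) ≃ Fin m
  col : Fin k ⊕ Fin (n - k) ≃ Fin n

namespace Pivoting

variable {m n k : ℕ}

/-- The indices of the `k` pivot rows. -/
def pivotRows (P : Pivoting m n k) : Fin k ↪ Fin m :=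
  Function.Embedding.inl.trans P.row.toEmbedding

/-- The indices of the `k` pivot columns. -/
def pivotCols (P : Pivoting m n k) : Fin k ↪ Fin n :=
  Function.Embedding.inl.trans P.col.toEmbedding

/-- The permuted matrix `P₁ A P₂`, as a `2 × 2` block matrix. -/
def permuted (P : Pivoting m n k) (A : Matrix (Fin m) (Fin n) ℝ) :
    Matrix (Fin k ⊕ Fin (m - k)) (Fin k ⊕ Fin (n - k)) ℝ :=
  A.submatrix P.row P.col

def A11 (P : Pivoting m n k) (A : Matrix (Fin m) (Fin n) ℝ) : Matrix (Fin k) (Fin k) ℝ :=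
  (P.permuted A).toBlocks₁₁

def A12 (P : Pivoting m n k) (A : Matrix (Fin m) (Fin n) ℝ) : Matrix (Fin k) (Fin (n - k)) ℝ :=
  (P.permuted A).toBlocks₁₂

def A21 (P : Pivoting m n k) (A : Matrix (Fin m) (Fin n) ℝ) : Matrix (Fin (m - k)) (Fin k) ℝ :=
  (P.permuted A).toBlocks₂₁

def A22 (P : Pivoting m n k) (A : Matrix (Fin m) (Fin n) ℝ) :
    Matrix (Fin (m - k)) (Fin (n - k)) ℝ :=
  (P.permuted A).toBlocks₂₂

/-- The Schur complement `S(A₁₁) = A₂₂ - A₂₁ A₁₁⁻¹ A₁₂`. -/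
noncomputable def schur (P : Pivoting m n k) (A : Matrix (Fin m) (Fin n) ℝ) :
    Matrix (Fin (m - k)) (Fin (n - k)) ℝ :=
  P.A22 A - P.A21 A * (P.A11 A)⁻¹ * P.A12 A

/-- The lower factor `[I, 0; A₂₁ A₁₁⁻¹, I]` of the partial LU factorization. -/
noncomputable def lower (P : Pivoting m n k) (A : Matrix (Fin m) (Fin n) ℝ) :
    Matrix (Fin k ⊕ Fin (m - k)) (Fin k ⊕ Fin (m - k)) ℝ :=
  Matrix.fromBlocks 1 0 (P.A21 A * (P.A11 A)⁻¹) 1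

/-- The upper factor `[A₁₁, A₁₂; 0, S(A₁₁)]` of the partial LU factorization. -/
noncomputable def upper (P : Pivoting m n k) (A : Matrix (Fin m) (Fin n) ℝ) :
    Matrix (Fin k ⊕ Fin (m - k)) (Fin k ⊕ Fin (n - k)) ℝ :=
  Matrix.fromBlocks (P.A11 A) (P.A12 A) 0 (P.schur A)

/-- The low-rank approximant
`A_k = P₁⁻¹ [A₁₁, A₁₂; A₂₁, A₂₁ A₁₁⁻¹ A₁₂] P₂⁻¹`. -/
noncomputable def approx (P : Pivoting m n k) (A : Matrix (Fin m) (Fin n) ℝ) :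
    Matrix (Fin m) (Fin n) ℝ :=
  (Matrix.fromBlocks (P.A11 A) (P.A12 A) (P.A21 A)
    (P.A21 A * (P.A11 A)⁻¹ * P.A12 A)).submatrix P.row.symm P.col.symm

/-- The pivot block `A₁₁` is a local maximum volume submatrix of `A`. -/
def IsLocalMaxVolumePivot (P : Pivoting m n k) (A : Matrix (Fin m) (Fin n) ℝ) : Prop :=
  IsLocalMaxVolume A P.pivotRows P.pivotCols

/-- Interpolative bounds with `ν`: all entries of `A₂₁ A₁₁⁻¹` and of `A₁₁⁻¹ A₁₂` are at most `ν`
in absolute value. -/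
def InterpolativeBounds (P : Pivoting m n k) (A : Matrix (Fin m) (Fin n) ℝ) (ν : ℝ) : Prop :=
  (∀ i j, |(P.A21 A * (P.A11 A)⁻¹) i j| ≤ ν) ∧ (∀ i j, |((P.A11 A)⁻¹ * P.A12 A) i j| ≤ ν)

end Pivoting

/-- A (possibly nondeterministic) low-rank approximation method, given by its input-output
relation: `alg m n A k B` says that on input `A`, `k` the method may return `B`. -/
def LowRankMethod : Type :=
  ∀ m n : ℕ, Matrix (Fin m) (Fin n) ℝ → ℕ → Matrix (Fin m) (Fin n) ℝ → Prop

/-- The method is a rank-revealer with factor `μ_{m,n,k}`: the factor is at least `1` and bounded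
by a polynomial, and for every matrix and every `1 ≤ k ≤ min(m,n)` the method returns something, and
whatever it returns is a matrix of rank at most `k` satisfying the two families of singular value
estimates. -/
structure IsRankRevealer (alg : LowRankMethod) (μ : ℕ → ℕ → ℕ → ℝ) : Prop where
  poly_bounded : ∃ p : MvPolynomial (Fin 3) ℝ, ∀ m n k : ℕ, 1 ≤ k → k ≤ min m n →
    μ m n k ≤ MvPolynomial.eval ![(m : ℝ), (n : ℝ), (k : ℝ)] p
  one_le : ∀ m n k : ℕ, 1 ≤ k → k ≤ min m n → 1 ≤ μ m n k
  exists_output : ∀ (m n : ℕ) (A : Matrix (Fin m) (Fin n) ℝ) (k : ℕ), 1 ≤ k → k ≤ min m n →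
    ∃ B, alg m n A k B
  rank_le : ∀ (m n : ℕ) (A : Matrix (Fin m) (Fin n) ℝ) (k : ℕ), 1 ≤ k → k ≤ min m n →
    ∀ B, alg m n A k B → B.rank ≤ k
  leading : ∀ (m n : ℕ) (A : Matrix (Fin m) (Fin n) ℝ) (k : ℕ), 1 ≤ k → k ≤ min m n →
    ∀ B, alg m n A k B → ∀ j : ℕ, 1 ≤ j → j ≤ k →
      1 / μ m n k * sigma A j ≤ sigma B j ∧ sigma B j ≤ μ m n k * sigma A j
  trailing : ∀ (m n : ℕ) (A : Matrix (Fin m) (Fin n) ℝ) (k : ℕ), 1 ≤ k → k ≤ min m n →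
    ∀ B, alg m n A k B → ∀ j : ℕ, 1 ≤ j → j ≤ min m n - k →
      1 / μ m n k * sigma A (k + j) ≤ sigma (A - B) j ∧
        sigma (A - B) j ≤ μ m n k * sigma A (k + j)

/-- Gaussian elimination with local maximum volume pivoting. The output is the approximant built
from any `k × k` local maximum volume pivot. If `rank A < k`, no such pivot exists (every `k × k`
submatrix is singular) and elimination stops after a local maximum volume pivot of size `rank A`. -/
def geLocalMaxVolume : LowRankMethod := fun m n A k B =>
  ∃ (r : ℕ) (P : Pivoting m n r), (r = k ∨ (r = A.rank ∧ r < k)) ∧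
    P.IsLocalMaxVolumePivot A ∧ B = P.approx A

end RankRevealing

/-!
Write `W = A₂₁ A₁₁⁻¹`, `V = A₁₁⁻¹ A₁₂` and `S` for the Schur complement of the pivot block. For
square submatrices the volume is the absolute value of the determinant (`vol_eq_abs_det`). By
Cramer's rule, exchanging a pivot row, or a pivot column, for another one multiplies the determinant by an entry of
`W`, or of `V`, and exchanging both multiplies it by `W p i * V j q + A₁₁⁻¹ j i * S p q`
(`det_updateRow_updateCol_eq`). At a local maximum none of these factors exceeds `1` in absolute
value. Hence the entries of `W` and `V` are bounded by `1`, which are the interpolative bounds, and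
`|A₁₁⁻¹ j i * S p q| ≤ 2`, so that the largest entry `s` of `S` satisfies `s ‖x‖ ≤ 2k ‖A₁₁ x‖`
(`exists_schur_bound`).

The singular value estimates use only the Courant–Fischer principle in the form of
`le_sigma_of_le_euclNorm_mulVec` and `sigma_le_of_euclNorm_mulVec_le`, and two consequences: Weyl's
inequality `sigma_add_le` and the monotonicity `sigma_mul_mul_le`.

* `σ_j(A_k) ≤ μ σ_j(A)`: up to permutations `A_k = [I, 0; W, 0] A [I, V; 0, 0]`.
* `σ_j(A) ≤ μ σ_j(A_k)`: by Weyl `σ_j(A) ≤ σ_j(A_k) + ‖S‖`, and `‖S‖ ≤ 2k √(mn) σ_k(A_k)`.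
* `σ_{k+j}(A) ≤ σ_j(A - A_k)`: Weyl's inequality, since `A_k` has rank at most `k`.
* `σ_j(A - A_k) ≤ μ σ_{k+j}(A)`: block elimination, with rescaled pivot rows and columns, turns `A`
  into `diag(αβ A₁₁, S)`, where `αβ` is chosen so large that every singular value of `αβ A₁₁` is at
  least every singular value of `S`. Then `σ_j(S)` is at most the singular value number `k + j` of
  this block diagonal matrix.

If `rank A < k`, the last estimate for a pivot of size `rank A` shows that the residual vanishes. A
pivot of size at most `rank A` exists because some submatrix of that size is nonsingular, and one of
globally maximal volume may be taken.
-/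

namespace RankRevealing

open Module

/-! ### The Courant–Fischer principle for linear maps -/

section LinearMap

variable {E F : Type*} [NormedAddCommGroup E] [InnerProductSpace ℝ E] [FiniteDimensional ℝ E]
  [NormedAddCommGroup F] [InnerProductSpace ℝ F] [FiniteDimensional ℝ F]

/-- In an orthonormal basis of right singular vectors, `‖T x‖²` is a weighted sum of squares. -/
theorem norm_sq_apply_eq_sum (T : E →ₗ[ℝ] F) {n : ℕ} (hn : finrank ℝ E = n) (x : E) :
    ‖T x‖ ^ 2 = ∑ i : Fin n, T.singularValues i ^ 2 *
      (T.isSymmetric_adjoint_comp_self.eigenvectorBasis hn).repr x i ^ 2 := by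
  set b := T.isSymmetric_adjoint_comp_self.eigenvectorBasis hn with hb
  have h1 : ‖T x‖ ^ 2 = inner ℝ ((T.adjoint ∘ₗ T) x) x := by
    rw [LinearMap.comp_apply, LinearMap.adjoint_inner_left, real_inner_self_eq_norm_sq]
  rw [h1, ← b.repr.inner_map_map, PiLp.inner_apply]
  refine Finset.sum_congr rfl fun i _ => ?_
  rw [hb, LinearMap.IsSymmetric.eigenvectorBasis_apply_self_apply, ← T.sq_singularValues_fin hn]
  simp
  ring

/-- On the orthogonal complement of the first `i` right singular vectors, which is the kernel of a
map to `ℝⁱ`, `T` expands by at most its singular value number `i` (counted from `0`). -/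
theorem exists_norm_apply_le_singularValues (T : E →ₗ[ℝ] F) (i : ℕ) :
    ∃ f : E →ₗ[ℝ] (Fin i → ℝ), ∀ x, f x = 0 → ‖T x‖ ≤ T.singularValues i * ‖x‖ := by
  classical
  set b := T.isSymmetric_adjoint_comp_self.eigenvectorBasis rfl with hb
  refine ⟨LinearMap.pi fun l => if h : (l : ℕ) < finrank ℝ E then
    (LinearMap.proj (⟨l, h⟩ : Fin (finrank ℝ E))) ∘ₗ (WithLp.linearEquiv 2 ℝ _).toLinearMap ∘ₗ
      b.repr.toLinearEquiv.toLinearMap else 0, fun x hx => ?_⟩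
  have hx' : ∀ l : Fin (finrank ℝ E), (l : ℕ) < i → b.repr x l = 0 := fun l hl => by
    have := congrFun hx ⟨l, hl⟩
    simpa using this
  refine le_of_sq_le_sq ?_ (mul_nonneg (T.singularValues_nonneg i) (norm_nonneg x))
  rw [norm_sq_apply_eq_sum T rfl, mul_pow, ← b.repr.norm_map x, EuclideanSpace.norm_sq_eq,
    Finset.mul_sum]
  refine Finset.sum_le_sum fun l _ => ?_
  rw [Real.norm_eq_abs, sq_abs]
  by_cases hl : (l : ℕ) < i
  · simp [← hb, hx' l hl]
  · gcongr
    · exact T.singularValues_nonneg _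
    · exact T.singularValues_antitone (not_lt.mp hl)

/-- On the span of the first `i + 1` right singular vectors, `T` expands by at least its singular
value number `i` (counted from `0`). -/
theorem exists_singularValues_le_norm_apply (T : E →ₗ[ℝ] F) {i : ℕ} (hi : i < finrank ℝ E) :
    ∃ g : (Fin (i + 1) → ℝ) →ₗ[ℝ] E, Function.Injective g ∧
      ∀ w, T.singularValues i * ‖g w‖ ≤ ‖T (g w)‖ := by
  classical
  set b := T.isSymmetric_adjoint_comp_self.eigenvectorBasis rfl with hb
  set e : Fin (i + 1) → Fin (finrank ℝ E) := Fin.castLE hi with he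
  have hinj : Function.Injective e := Fin.castLE_injective hi
  let g : (Fin (i + 1) → ℝ) →ₗ[ℝ] E := Fintype.linearCombination ℝ (fun l => b (e l))
  have hg : ∀ w, g w = ∑ l, w l • b (e l) := fun w => Fintype.linearCombination_apply ..
  have hli : LinearIndependent ℝ (fun l => b (e l)) :=
    (b.orthonormal.comp e hinj).linearIndependent
  refine ⟨g, ?_, fun w => ?_⟩
  · exact hli.fintypeLinearCombination_injective
  refine le_of_sq_le_sq ?_ (norm_nonneg _)
  rw [norm_sq_apply_eq_sum T rfl, mul_pow, ← b.repr.norm_map (g w), EuclideanSpace.norm_sq_eq,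
    Finset.mul_sum]
  refine Finset.sum_le_sum fun l _ => ?_
  rw [Real.norm_eq_abs, sq_abs, ← hb]
  by_cases hl : (l : ℕ) ≤ i
  · gcongr
    · exact T.singularValues_nonneg _
    · exact T.singularValues_antitone hl
  · have : b.repr (g w) l = 0 := by
      rw [b.repr_apply_apply, hg, inner_sum]
      refine Finset.sum_eq_zero fun p _ => ?_
      rw [inner_smul_right, b.inner_eq_ite, if_neg, mul_zero]
      rintro rfl
      exact hl (Nat.lt_succ_iff.mp p.2)
    simp [this]

/-- An injective map from a space of larger dimension than the target of `f` hits `ker f`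
nontrivially. -/
theorem exists_ne_zero_of_finrank_lt {V W U : Type*} [AddCommGroup V] [Module ℝ V]
    [AddCommGroup W] [Module ℝ W] [AddCommGroup U] [Module ℝ U] [FiniteDimensional ℝ W]
    [FiniteDimensional ℝ U]
    (g : W →ₗ[ℝ] V) (hg : Function.Injective g) (f : V →ₗ[ℝ] U)
    (h : finrank ℝ U < finrank ℝ W) : ∃ w, g w ≠ 0 ∧ f (g w) = 0 := by
  have : (f ∘ₗ g).ker ≠ ⊥ := LinearMap.ker_ne_bot_of_finrank_lt h
  obtain ⟨w, hw, hw0⟩ := (Submodule.ne_bot_iff _).mp this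
  exact ⟨w, fun h0 => hw0 (hg (by rw [h0, map_zero])), hw⟩

/-- Lower half of the Courant–Fischer principle. The subspace is given as the image of an injective
map. -/
theorem le_singularValues_of_le_norm_apply (T : E →ₗ[ℝ] F) {i : ℕ} {W : Type*} [AddCommGroup W]
    [Module ℝ W] [FiniteDimensional ℝ W] (hW : i < finrank ℝ W) (g : W →ₗ[ℝ] E)
    (hg : Function.Injective g) {t : ℝ} (h : ∀ w, t * ‖g w‖ ≤ ‖T (g w)‖) :
    t ≤ T.singularValues i := by
  obtain ⟨f, hf⟩ := exists_norm_apply_le_singularValues T i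
  obtain ⟨w, hw0, hw⟩ := exists_ne_zero_of_finrank_lt g hg f (by simpa using hW)
  exact le_of_mul_le_mul_right ((h w).trans (hf _ hw)) (norm_pos_iff.mpr hw0)

/-- Upper half of the Courant–Fischer principle. The subspace is given as a kernel. -/
theorem singularValues_le_of_norm_apply_le (T : E →ₗ[ℝ] F) {i : ℕ} {U : Type*} [AddCommGroup U]
    [Module ℝ U] [FiniteDimensional ℝ U] (hU : finrank ℝ U ≤ i) (f : E →ₗ[ℝ] U) {t : ℝ}
    (ht : 0 ≤ t) (h : ∀ x, f x = 0 → ‖T x‖ ≤ t * ‖x‖) : T.singularValues i ≤ t := by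
  by_cases hi : i < finrank ℝ E
  · obtain ⟨g, hg, hgT⟩ := exists_singularValues_le_norm_apply T hi
    obtain ⟨w, hw0, hw⟩ := exists_ne_zero_of_finrank_lt g hg f
      (by simpa using hU.trans_lt i.lt_succ_self)
    exact le_of_mul_le_mul_right ((hgT w).trans (h _ hw)) (norm_pos_iff.mpr hw0)
  · rw [T.singularValues_of_finrank_le (not_lt.mp hi)]
    exact ht

end LinearMap

/-! ### Singular values of matrices -/

section Matrix

variable {ι κ ι' κ' : Type*} [Fintype ι] [Fintype κ] [Fintype ι'] [Fintype κ']

/-- The Euclidean norm of a coordinate vector (whose own norm in Mathlib is the sup norm). -/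
noncomputable def euclNorm (x : ι → ℝ) : ℝ := ‖WithLp.toLp 2 x‖

theorem euclNorm_nonneg (x : ι → ℝ) : 0 ≤ euclNorm x := norm_nonneg _

theorem euclNorm_add_le (x y : ι → ℝ) : euclNorm (x + y) ≤ euclNorm x + euclNorm y := by
  rw [euclNorm, WithLp.toLp_add]
  exact norm_add_le _ _

theorem euclNorm_neg (x : ι → ℝ) : euclNorm (-x) = euclNorm x := by
  rw [euclNorm, WithLp.toLp_neg, norm_neg, euclNorm]

theorem euclNorm_smul (c : ℝ) (x : ι → ℝ) : euclNorm (c • x) = |c| * euclNorm x := by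
  rw [euclNorm, WithLp.toLp_smul, norm_smul, Real.norm_eq_abs, euclNorm]

theorem euclNorm_sq (x : ι → ℝ) : euclNorm x ^ 2 = ∑ i, x i ^ 2 := by
  simp [euclNorm, EuclideanSpace.norm_sq_eq]

theorem euclNorm_sumElim_sq (x : ι → ℝ) (y : κ → ℝ) :
    euclNorm (Sum.elim x y) ^ 2 = euclNorm x ^ 2 + euclNorm y ^ 2 := by
  simp [euclNorm_sq]

theorem euclNorm_zero : euclNorm (0 : ι → ℝ) = 0 := by simp [euclNorm]

theorem euclNorm_le_of_sq_le {x : ι → ℝ} {c : ℝ} (hc : 0 ≤ c) (h : euclNorm x ^ 2 ≤ c ^ 2) :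
    euclNorm x ≤ c := le_of_sq_le_sq h hc

/-- A matrix with entries bounded by `s` has Euclidean operator norm at most its Frobenius bound
`s √(mn)`. -/
theorem euclNorm_mulVec_le (S : Matrix ι κ ℝ) {s : ℝ} (h : ∀ i j, |S i j| ≤ s)
    (hs : 0 ≤ s) (x : κ → ℝ) :
    euclNorm (S.mulVec x) ≤ s * √((Fintype.card ι : ℝ) * Fintype.card κ) * euclNorm x := by
  refine euclNorm_le_of_sq_le (by have := euclNorm_nonneg x; positivity) ?_
  rw [mul_pow, mul_pow, Real.sq_sqrt (by positivity), euclNorm_sq, euclNorm_sq]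
  have key : ∀ i, (S.mulVec x) i ^ 2 ≤ s ^ 2 * Fintype.card κ * ∑ j, x j ^ 2 := fun i => by
    refine (Finset.sum_mul_sq_le_sq_mul_sq Finset.univ (S i) x).trans ?_
    gcongr
    calc ∑ j, S i j ^ 2 ≤ ∑ _j : κ, s ^ 2 :=
          Finset.sum_le_sum fun j _ => sq_le_sq.mpr (by rw [abs_of_nonneg hs]; exact h i j)
      _ = s ^ 2 * Fintype.card κ := by simp [mul_comm]
  refine (Finset.sum_le_sum fun i _ => key i).trans (le_of_eq ?_)
  simp
  ring

variable [DecidableEq κ] [DecidableEq κ']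

theorem sigma_nonneg (A : Matrix ι κ ℝ) (j : ℕ) : 0 ≤ sigma A j :=
  LinearMap.singularValues_nonneg _ _

theorem sigma_antitone (A : Matrix ι κ ℝ) : Antitone (sigma A) := fun _ _ h =>
  LinearMap.singularValues_antitone _ (Nat.sub_le_sub_right h 1)

theorem exists_euclNorm_mulVec_le_sigma (A : Matrix ι κ ℝ) (j : ℕ) :
    ∃ f : (κ → ℝ) →ₗ[ℝ] (Fin (j - 1) → ℝ), ∀ x, f x = 0 →
      euclNorm (A.mulVec x) ≤ sigma A j * euclNorm x := by
  obtain ⟨f, hf⟩ := exists_norm_apply_le_singularValues (Matrix.toEuclideanLin A) (j - 1)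
  exact ⟨f ∘ₗ (WithLp.linearEquiv 2 ℝ _).symm.toLinearMap, fun x hx => hf (WithLp.toLp 2 x) hx⟩

theorem exists_sigma_le_euclNorm_mulVec (A : Matrix ι κ ℝ) {j : ℕ} (hj1 : 1 ≤ j)
    (hj : j ≤ Fintype.card κ) :
    ∃ g : (Fin j → ℝ) →ₗ[ℝ] (κ → ℝ), Function.Injective g ∧
      ∀ w, sigma A j * euclNorm (g w) ≤ euclNorm (A.mulVec (g w)) := by
  obtain ⟨i, rfl⟩ : ∃ i, j = i + 1 := ⟨j - 1, by omega⟩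
  obtain ⟨g, hg, h⟩ := exists_singularValues_le_norm_apply (Matrix.toEuclideanLin A) (i := i)
    (by simpa using hj)
  exact ⟨(WithLp.linearEquiv 2 ℝ _).toLinearMap ∘ₗ g,
    (WithLp.linearEquiv 2 ℝ _).injective.comp hg, h⟩

theorem le_sigma_of_le_euclNorm_mulVec (A : Matrix ι κ ℝ) {j : ℕ} (hj1 : 1 ≤ j) {W : Type*}
    [AddCommGroup W] [Module ℝ W] [FiniteDimensional ℝ W] (hW : j ≤ finrank ℝ W)
    (g : W →ₗ[ℝ] (κ → ℝ)) (hg : Function.Injective g) {t : ℝ}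
    (h : ∀ w, t * euclNorm (g w) ≤ euclNorm (A.mulVec (g w))) : t ≤ sigma A j :=
  le_singularValues_of_le_norm_apply (Matrix.toEuclideanLin A) (i := j - 1) (by omega)
    ((WithLp.linearEquiv 2 ℝ _).symm.toLinearMap ∘ₗ g)
    ((WithLp.linearEquiv 2 ℝ _).symm.injective.comp hg) h

theorem sigma_le_of_euclNorm_mulVec_le (A : Matrix ι κ ℝ) {j : ℕ} {U : Type*} [AddCommGroup U]
    [Module ℝ U] [FiniteDimensional ℝ U] (hU : finrank ℝ U ≤ j - 1) (f : (κ → ℝ) →ₗ[ℝ] U) {t : ℝ}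
    (ht : 0 ≤ t) (h : ∀ x, f x = 0 → euclNorm (A.mulVec x) ≤ t * euclNorm x) : sigma A j ≤ t :=
  singularValues_le_of_norm_apply_le (Matrix.toEuclideanLin A) hU
    (f ∘ₗ (WithLp.linearEquiv 2 ℝ _).toLinearMap) ht fun x hx => h x.ofLp hx

/-- Singular values are monotone under domination: if `A` is bounded by `c₁ B Y` and `Y` is bounded
by `c₂`, then `σ_j(A) ≤ c₁ c₂ σ_j(B)`. -/
theorem sigma_le_of_dominated (A : Matrix ι κ ℝ) (B : Matrix ι' κ' ℝ)
    (Y : (κ → ℝ) →ₗ[ℝ] (κ' → ℝ)) {c₁ c₂ : ℝ} (h₁ : 0 ≤ c₁) (h₂ : 0 ≤ c₂)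
    (hA : ∀ x, euclNorm (A.mulVec x) ≤ c₁ * euclNorm (B.mulVec (Y x)))
    (hY : ∀ x, euclNorm (Y x) ≤ c₂ * euclNorm x) (j : ℕ) :
    sigma A j ≤ c₁ * c₂ * sigma B j := by
  obtain ⟨f, hf⟩ := exists_euclNorm_mulVec_le_sigma B j
  have hB := sigma_nonneg B j
  refine sigma_le_of_euclNorm_mulVec_le A (by simp) (f ∘ₗ Y) (by positivity) fun x hx => ?_
  calc euclNorm (A.mulVec x) ≤ c₁ * euclNorm (B.mulVec (Y x)) := hA x
    _ ≤ c₁ * (sigma B j * (c₂ * euclNorm x)) := by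
        gcongr
        exact (hf _ hx).trans (by gcongr; exact hY x)
    _ = _ := by ring

/-- Multiplication by matrices of operator norm at most `c₁` and `c₂` increases the singular values
by a factor of at most `c₁ c₂`. -/
theorem sigma_mul_mul_le (X : Matrix ι ι' ℝ) (B : Matrix ι' κ' ℝ) (Y : Matrix κ' κ ℝ) {c₁ c₂ : ℝ}
    (h₁ : 0 ≤ c₁) (h₂ : 0 ≤ c₂)
    (hX : ∀ x, euclNorm (X.mulVec x) ≤ c₁ * euclNorm x)
    (hY : ∀ x, euclNorm (Y.mulVec x) ≤ c₂ * euclNorm x) (j : ℕ) :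
    sigma (X * B * Y) j ≤ c₁ * c₂ * sigma B j :=
  sigma_le_of_dominated _ B Y.mulVecLin h₁ h₂
    (fun x => by
      rw [← Matrix.mulVec_mulVec, ← Matrix.mulVec_mulVec]
      exact hX _) hY j

theorem euclNorm_comp_equiv (e : ι' ≃ ι) (x : ι → ℝ) : euclNorm (x ∘ e) = euclNorm x := by
  rw [← sq_eq_sq₀ (euclNorm_nonneg _) (euclNorm_nonneg _), euclNorm_sq, euclNorm_sq]
  exact e.sum_comp fun i => x i ^ 2

theorem sigma_submatrix_equiv_le (A : Matrix ι κ ℝ) (e : ι' ≃ ι) (f : κ' ≃ κ) (j : ℕ) :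
    sigma (A.submatrix e f) j ≤ sigma A j := by
  have := sigma_le_of_dominated (A.submatrix e f) A
    (LinearMap.funLeft ℝ ℝ f.symm) zero_le_one zero_le_one
    (fun x => by
      rw [Matrix.submatrix_mulVec_equiv, euclNorm_comp_equiv, one_mul]
      exact le_rfl)
    (fun x => by
      rw [one_mul]
      exact (euclNorm_comp_equiv f.symm x).le) j
  simpa using this

theorem sigma_submatrix_equiv (A : Matrix ι κ ℝ) (e : ι' ≃ ι) (f : κ' ≃ κ) (j : ℕ) :
    sigma (A.submatrix e f) j = sigma A j :=
  le_antisymm (sigma_submatrix_equiv_le A e f j) <| by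
    simpa using sigma_submatrix_equiv_le (A.submatrix e f) e.symm f.symm j

/-- Weyl's inequality. -/
theorem sigma_add_le (A B : Matrix ι κ ℝ) {j : ℕ} (hj : 1 ≤ j) (i : ℕ) :
    sigma (A + B) (i + j) ≤ sigma A (i + 1) + sigma B j := by
  obtain ⟨f, hf⟩ := exists_euclNorm_mulVec_le_sigma A (i + 1)
  obtain ⟨g, hg⟩ := exists_euclNorm_mulVec_le_sigma B j
  refine sigma_le_of_euclNorm_mulVec_le _ (by simp; omega) (f.prod g)
    (add_nonneg (sigma_nonneg _ _) (sigma_nonneg _ _)) fun x hx => ?_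
  obtain ⟨hx1, hx2⟩ := Prod.mk.inj hx
  rw [Matrix.add_mulVec, add_mul]
  exact (euclNorm_add_le _ _).trans (add_le_add (hf x hx1) (hg x hx2))

theorem sigma_le_of_forall_euclNorm_mulVec_le (A : Matrix ι κ ℝ) {c : ℝ} (hc : 0 ≤ c)
    (h : ∀ x, euclNorm (A.mulVec x) ≤ c * euclNorm x) (j : ℕ) : sigma A j ≤ c :=
  sigma_le_of_euclNorm_mulVec_le A (U := Fin 0 → ℝ) (by simp) 0 hc fun x _ => h x

theorem sigma_eq_zero_iff_rank_lt (A : Matrix ι κ ℝ) {j : ℕ} (hj : 1 ≤ j) :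
    sigma A j = 0 ↔ A.rank < j := by
  rw [sigma, LinearMap.singularValues_eq_zero_iff_le_finrank_range,
    Matrix.toEuclideanLin, Matrix.toLpLin_eq_toLin, ← Matrix.rank_eq_finrank_range_toLin]
  omega

theorem sigma_eq_zero_of_card_lt (A : Matrix ι κ ℝ) {j : ℕ} (h : Fintype.card κ < j) :
    sigma A j = 0 :=
  LinearMap.singularValues_of_finrank_le _ (by simp; omega)

/-- The volume of a square matrix is the absolute value of its determinant. -/
theorem vol_eq_abs_det {p : ℕ} (B : Matrix (Fin p) (Fin p) ℝ) : vol B = |B.det| := by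
  rw [← LinearMap.det_toLin (PiLp.basisFun 2 ℝ (Fin p)) B, ← Matrix.toLpLin_eq_toLin,
    ← LinearMap.normDet_eq_abs_det, LinearMap.normDet_eq_prod_singularValues, vol, min_self,
    ← Finset.Ico_add_one_right_eq_Icc, Finset.prod_Ico_eq_prod_range]
  simp [sigma]

end Matrix

open Matrix

/-! ### Determinants after exchanging a row and a column -/

section Exchange

variable {n : Type*} [Fintype n] [DecidableEq n] {M : Matrix n n ℝ}

theorem adjugate_eq_det_smul_inv (hM : M.det ≠ 0) : M.adjugate = M.det • M⁻¹ := by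
  rw [Matrix.inv_def, Ring.inverse_eq_inv', smul_smul, mul_inv_cancel₀ hM, one_smul]

theorem det_updateRow_eq (hM : M.det ≠ 0) (i : n) (b : n → ℝ) :
    (M.updateRow i b).det = M.det * (b ᵥ* M⁻¹) i := by
  rw [← Matrix.cramer_transpose_apply, Matrix.cramer_eq_adjugate_mulVec,
    ← Matrix.adjugate_transpose, Matrix.mulVec_transpose, adjugate_eq_det_smul_inv hM,
    Matrix.vecMul_smul]
  rfl

theorem det_updateCol_eq (hM : M.det ≠ 0) (j : n) (a : n → ℝ) :
    (M.updateCol j a).det = M.det * (M⁻¹ *ᵥ a) j := by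
  rw [← Matrix.cramer_apply, Matrix.cramer_eq_adjugate_mulVec, adjugate_eq_det_smul_inv hM,
    Matrix.smul_mulVec]
  rfl

/-- The determinant after exchanging row `i` and column `j` simultaneously. The vectors `b`, `a`
and the number `d` are the new row, the new column and the entry where they cross. -/
theorem det_updateRow_updateCol_eq (hM : M.det ≠ 0) (i j : n) (b a : n → ℝ) (d : ℝ) :
    ((M.updateRow i b).updateCol j (Function.update a i d)).det =
      M.det * ((b ᵥ* M⁻¹) i * (M⁻¹ *ᵥ a) j + M⁻¹ j i * (d - b ⬝ᵥ (M⁻¹ *ᵥ a))) := by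
  set N := M.updateRow i b with hN
  have hu : IsUnit M.det := isUnit_iff_ne_zero.mpr hM
  -- The new column is `N V` for `V = M⁻¹ a`, apart from a correction in the entry `i`.
  have hcol : Function.update a i d =
      N *ᵥ (M⁻¹ *ᵥ a) + (d - b ⬝ᵥ (M⁻¹ *ᵥ a)) • Pi.single i 1 := by
    ext l
    rcases eq_or_ne l i with rfl | hl
    · have : (N *ᵥ (M⁻¹ *ᵥ a)) l = b ⬝ᵥ (M⁻¹ *ᵥ a) := by
        change N l ⬝ᵥ _ = _
        rw [hN, Matrix.updateRow_self]
      rw [Function.update_self, Pi.add_apply, this, Pi.smul_apply, Pi.single_eq_same,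
        smul_eq_mul, mul_one, add_sub_cancel]
    · have : M l ⬝ᵥ (M⁻¹ *ᵥ a) = a l := by
        change (M *ᵥ (M⁻¹ *ᵥ a)) l = a l
        rw [Matrix.mulVec_mulVec, Matrix.mul_nonsing_inv _ hu, Matrix.one_mulVec]
      simp only [Function.update_of_ne hl, Pi.add_apply, Matrix.mulVec, hN,
        Matrix.updateRow_ne hl, Pi.smul_apply, Pi.single_eq_of_ne hl, smul_zero, add_zero]
      exact this.symm
  have hadj : N.adjugate j i = M.adjugate j i := by
    rw [Matrix.adjugate_apply, Matrix.adjugate_apply, hN, Matrix.updateRow_idem]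
  rw [← Matrix.cramer_apply, Matrix.cramer_eq_adjugate_mulVec, hcol, Matrix.mulVec_add,
    Matrix.mulVec_mulVec, Matrix.adjugate_mul, Matrix.mulVec_smul, Matrix.smul_mulVec,
    Matrix.one_mulVec, Matrix.mulVec_single_one, Pi.add_apply, Pi.smul_apply, Pi.smul_apply,
    Matrix.col_apply, hadj, hN, det_updateRow_eq hM, adjugate_eq_det_smul_inv hM,
    Matrix.smul_apply]
  simp only [smul_eq_mul]
  ring

end Exchange

/-! ### Consequences of local maximality of the volume -/

/-- The index selection `r` with its `i`-th index replaced by `x`, meant for an `x` that `r` does not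
select. If `r` does select `x`, the transposition in the definition only reorders the indices. -/
def replaceIndex {k m : ℕ} (r : Fin k ↪ Fin m) (i : Fin k) (x : Fin m) : Fin k ↪ Fin m :=
  r.trans (Equiv.swap (r i) x).toEmbedding

theorem replaceIndex_self {k m : ℕ} (r : Fin k ↪ Fin m) (i : Fin k) (x : Fin m) :
    replaceIndex r i x i = x := by simp [replaceIndex]

theorem replaceIndex_of_ne {k m : ℕ} (r : Fin k ↪ Fin m) {i : Fin k} {x : Fin m}
    (hx : ∀ l, r l ≠ x) {l : Fin k} (hl : l ≠ i) : replaceIndex r i x l = r l := by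
  simp [replaceIndex, Equiv.swap_apply_of_ne_of_ne (r.injective.ne hl) (hx l)]

theorem card_sdiff_replaceIndex_le {k m : ℕ} (r : Fin k ↪ Fin m) {i : Fin k} {x : Fin m}
    (hx : ∀ l, r l ≠ x) :
    (Finset.univ.map r \ Finset.univ.map (replaceIndex r i x)).card ≤ 1 := by
  refine (Finset.card_le_card (t := {r i}) fun y hy => ?_).trans (Finset.card_singleton _).le
  rw [Finset.mem_sdiff] at hy
  obtain ⟨l, -, rfl⟩ := Finset.mem_map.mp hy.1
  rcases eq_or_ne l i with rfl | hl
  · simp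
  · exact absurd (Finset.mem_map.mpr ⟨l, Finset.mem_univ _, replaceIndex_of_ne r hx hl⟩) hy.2

namespace Pivoting

variable {m n k : ℕ} {P : Pivoting m n k} {A : Matrix (Fin m) (Fin n) ℝ}

theorem pivotRows_ne (P : Pivoting m n k) (p : Fin (m - k)) (l : Fin k) :
    P.pivotRows l ≠ P.row (Sum.inr p) := fun h => by
  cases P.row.injective h

theorem pivotCols_ne (P : Pivoting m n k) (q : Fin (n - k)) (l : Fin k) :
    P.pivotCols l ≠ P.col (Sum.inr q) := fun h => by
  cases P.col.injective h

theorem permuted_eq_fromBlocks (P : Pivoting m n k) (A : Matrix (Fin m) (Fin n) ℝ) :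
    P.permuted A = fromBlocks (P.A11 A) (P.A12 A) (P.A21 A) (P.A22 A) :=
  (fromBlocks_toBlocks _).symm

theorem IsLocalMaxVolumePivot.det_ne_zero (h : P.IsLocalMaxVolumePivot A) :
    (P.A11 A).det ≠ 0 := by
  have := h.1
  rw [vol_eq_abs_det] at this
  exact abs_pos.mp this

theorem IsLocalMaxVolumePivot.abs_det_le (h : P.IsLocalMaxVolumePivot A)
    (r' : Fin k ↪ Fin m) (c' : Fin k ↪ Fin n)
    (hr : (Finset.univ.map P.pivotRows \ Finset.univ.map r').card ≤ 1)
    (hc : (Finset.univ.map P.pivotCols \ Finset.univ.map c').card ≤ 1) :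
    |(A.submatrix r' c').det| ≤ |(P.A11 A).det| := by
  have := h.2 r' c' hr hc
  rwa [vol_eq_abs_det, vol_eq_abs_det] at this

theorem IsLocalMaxVolumePivot.abs_A21_mul_inv_le_one (h : P.IsLocalMaxVolumePivot A)
    (p : Fin (m - k)) (i : Fin k) : |(P.A21 A * (P.A11 A)⁻¹) p i| ≤ 1 := by
  have h0 := h.det_ne_zero
  have hle := h.abs_det_le (replaceIndex P.pivotRows i (P.row (Sum.inr p))) P.pivotCols
    (card_sdiff_replaceIndex_le _ (P.pivotRows_ne p)) (by simp)
  have heq : A.submatrix (replaceIndex P.pivotRows i (P.row (Sum.inr p))) P.pivotCols =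
      (P.A11 A).updateRow i (P.A21 A p) := by
    ext l l'
    rcases eq_or_ne l i with rfl | hl
    · rw [updateRow_self, submatrix_apply, replaceIndex_self]
      rfl
    · rw [updateRow_ne hl, submatrix_apply, replaceIndex_of_ne _ (P.pivotRows_ne p) hl]
      rfl
  rw [heq, det_updateRow_eq h0, abs_mul] at hle
  exact le_of_mul_le_mul_left (by rw [mul_one]; exact hle) (abs_pos.mpr h0)

theorem IsLocalMaxVolumePivot.abs_inv_mul_A12_le_one (h : P.IsLocalMaxVolumePivot A)
    (j : Fin k) (q : Fin (n - k)) : |((P.A11 A)⁻¹ * P.A12 A) j q| ≤ 1 := by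
  have h0 := h.det_ne_zero
  have hle := h.abs_det_le P.pivotRows (replaceIndex P.pivotCols j (P.col (Sum.inr q)))
    (by simp) (card_sdiff_replaceIndex_le _ (P.pivotCols_ne q))
  have heq : A.submatrix P.pivotRows (replaceIndex P.pivotCols j (P.col (Sum.inr q))) =
      (P.A11 A).updateCol j (fun l => P.A12 A l q) := by
    ext l l'
    rcases eq_or_ne l' j with rfl | hl
    · rw [updateCol_self, submatrix_apply, replaceIndex_self]
      rfl
    · rw [updateCol_ne hl, submatrix_apply, replaceIndex_of_ne _ (P.pivotCols_ne q) hl]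
      rfl
  rw [heq, det_updateCol_eq h0, abs_mul] at hle
  exact le_of_mul_le_mul_left (by rw [mul_one]; exact hle) (abs_pos.mpr h0)

/-- Exchanging one row and one column simultaneously multiplies the determinant by
`W p i * V j q + A₁₁⁻¹ j i * S p q`, where `W = A₂₁ A₁₁⁻¹` and `V = A₁₁⁻¹ A₁₂` have entries at most
`1`. -/
theorem IsLocalMaxVolumePivot.abs_inv_mul_schur_le_two (h : P.IsLocalMaxVolumePivot A)
    (j i : Fin k) (p : Fin (m - k)) (q : Fin (n - k)) :
    |(P.A11 A)⁻¹ j i * P.schur A p q| ≤ 2 := by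
  have h0 := h.det_ne_zero
  have hle := h.abs_det_le (replaceIndex P.pivotRows i (P.row (Sum.inr p)))
    (replaceIndex P.pivotCols j (P.col (Sum.inr q)))
    (card_sdiff_replaceIndex_le _ (P.pivotRows_ne p))
    (card_sdiff_replaceIndex_le _ (P.pivotCols_ne q))
  have heq : A.submatrix (replaceIndex P.pivotRows i (P.row (Sum.inr p)))
      (replaceIndex P.pivotCols j (P.col (Sum.inr q))) =
      ((P.A11 A).updateRow i (P.A21 A p)).updateCol j
        (Function.update (fun l => P.A12 A l q) i (P.A22 A p q)) := by
    ext l l'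
    rw [submatrix_apply]
    rcases eq_or_ne l' j with rfl | hl'
    · rw [updateCol_self, replaceIndex_self]
      rcases eq_or_ne l i with rfl | hl
      · rw [Function.update_self, replaceIndex_self]
        rfl
      · rw [Function.update_of_ne hl, replaceIndex_of_ne _ (P.pivotRows_ne p) hl]
        rfl
    · rw [updateCol_ne hl', replaceIndex_of_ne _ (P.pivotCols_ne q) hl']
      rcases eq_or_ne l i with rfl | hl
      · rw [updateRow_self, replaceIndex_self]
        rfl
      · rw [updateRow_ne hl, replaceIndex_of_ne _ (P.pivotRows_ne p) hl]
        rfl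
  rw [heq, det_updateRow_updateCol_eq h0, abs_mul] at hle
  have hS : P.A22 A p q - P.A21 A p ⬝ᵥ ((P.A11 A)⁻¹ *ᵥ fun l => P.A12 A l q) =
      P.schur A p q := by
    rw [schur, Matrix.mul_assoc]
    rfl
  have h1 := le_of_mul_le_mul_left (hle.trans_eq (mul_one _).symm) (abs_pos.mpr h0)
  rw [hS] at h1
  have hW : |(P.A21 A p ᵥ* (P.A11 A)⁻¹) i| ≤ 1 := h.abs_A21_mul_inv_le_one p i
  have hV : |((P.A11 A)⁻¹ *ᵥ fun l => P.A12 A l q) j| ≤ 1 := h.abs_inv_mul_A12_le_one j q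
  have hWV : |(P.A21 A p ᵥ* (P.A11 A)⁻¹) i * ((P.A11 A)⁻¹ *ᵥ fun l => P.A12 A l q) j| ≤ 1 := by
    rw [abs_mul]
    exact mul_le_one₀ hW (abs_nonneg _) hV
  rw [abs_le] at *
  constructor <;> linarith

theorem IsLocalMaxVolumePivot.interpolativeBounds (h : P.IsLocalMaxVolumePivot A) :
    P.InterpolativeBounds A 1 :=
  ⟨h.abs_A21_mul_inv_le_one, h.abs_inv_mul_A12_le_one⟩

theorem permuted_eq_lower_mul_upper (hdet : (P.A11 A).det ≠ 0) :
    P.permuted A = P.lower A * P.upper A := by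
  have hu : IsUnit (P.A11 A).det := isUnit_iff_ne_zero.mpr hdet
  rw [permuted_eq_fromBlocks, lower, upper, fromBlocks_multiply]
  simp [schur, Matrix.mul_assoc, Matrix.nonsing_inv_mul _ hu]

/-- The pivot block dominates the Schur complement: the largest entry of the latter is at most
`2k σ_k(A₁₁)`. -/
theorem IsLocalMaxVolumePivot.exists_schur_bound (h : P.IsLocalMaxVolumePivot A) :
    ∃ s : ℝ, 0 ≤ s ∧ (∀ p q, |P.schur A p q| ≤ s) ∧
      ∀ x, s * euclNorm x ≤ 2 * k * euclNorm (P.A11 A *ᵥ x) := by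
  rcases isEmpty_or_nonempty (Fin (m - k) × Fin (n - k)) with hE | hE
  · exact ⟨0, le_rfl, fun p q => hE.elim (p, q), fun x => by
      have := euclNorm_nonneg (P.A11 A *ᵥ x)
      rw [zero_mul]
      positivity⟩
  obtain ⟨⟨p, q⟩, hmax⟩ := Finite.exists_max fun z : Fin (m - k) × Fin (n - k) =>
    |P.schur A z.1 z.2|
  refine ⟨|P.schur A p q|, abs_nonneg _, fun p' q' => hmax (p', q'), fun x => ?_⟩
  have hu : IsUnit (P.A11 A).det := isUnit_iff_ne_zero.mpr h.det_ne_zero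
  have := euclNorm_mulVec_le (P.schur A p q • (P.A11 A)⁻¹) (s := 2)
    (fun j i => by
      rw [Matrix.smul_apply, smul_eq_mul, mul_comm]
      exact h.abs_inv_mul_schur_le_two j i p q) zero_le_two (P.A11 A *ᵥ x)
  rwa [Matrix.smul_mulVec, Matrix.mulVec_mulVec, Matrix.nonsing_inv_mul _ hu, Matrix.one_mulVec,
    euclNorm_smul, Fintype.card_fin, Real.sqrt_mul_self (Nat.cast_nonneg k)] at this

end Pivoting

/-! ### Operator norms of block triangular matrices -/

theorem euclNorm_eq_sumElim {ι κ : Type*} [Fintype ι] [Fintype κ] (x : ι ⊕ κ → ℝ) :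
    euclNorm x ^ 2 = euclNorm (x ∘ Sum.inl) ^ 2 + euclNorm (x ∘ Sum.inr) ^ 2 := by
  rw [← euclNorm_sumElim_sq, Sum.elim_comp_inl_inr]

/-- The factor `√(a + 1 + w²)` in the operator norm bound of a block triangular matrix comes from
the Cauchy–Schwarz inequality `(w u + v)² ≤ (w² + 1) (u² + v²)`. -/
theorem euclNorm_lowerBlock_mulVec_le {ι κ : Type*} [Fintype ι] [Fintype κ] [DecidableEq ι]
    [DecidableEq κ] (W : Matrix ι κ ℝ) {w α δ : ℝ} (hδ : |δ| ≤ 1)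
    (hW : ∀ x, euclNorm (W *ᵥ x) ≤ w * euclNorm x) (x : κ ⊕ ι → ℝ) :
    euclNorm (fromBlocks (α • (1 : Matrix κ κ ℝ)) 0 W (δ • (1 : Matrix ι ι ℝ)) *ᵥ x) ≤
      √(α ^ 2 + 1 + w ^ 2) * euclNorm x := by
  have hx := euclNorm_nonneg x
  refine euclNorm_le_of_sq_le (by positivity) ?_
  rw [mul_pow, Real.sq_sqrt (by positivity), fromBlocks_mulVec, euclNorm_sumElim_sq,
    euclNorm_eq_sumElim x]
  set u := x ∘ Sum.inl
  set v := x ∘ Sum.inr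
  have hu := euclNorm_nonneg u
  have hv := euclNorm_nonneg v
  rw [zero_mulVec, add_zero, smul_mulVec, one_mulVec, smul_mulVec, one_mulVec, euclNorm_smul,
    mul_pow, sq_abs]
  have h1 : euclNorm (W *ᵥ u + δ • v) ≤ w * euclNorm u + euclNorm v := by
    refine (euclNorm_add_le _ _).trans (add_le_add (hW u) ?_)
    rw [euclNorm_smul]
    exact mul_le_of_le_one_left hv hδ
  have h2 := pow_le_pow_left₀ (euclNorm_nonneg _) h1 2
  nlinarith [sq_nonneg (euclNorm u - w * euclNorm v),
    mul_nonneg (sq_nonneg α) (sq_nonneg (euclNorm v))]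

/-- The mirror image of `euclNorm_lowerBlock_mulVec_le`, for an upper triangular block matrix. -/
theorem euclNorm_upperBlock_mulVec_le {ι κ : Type*} [Fintype ι] [Fintype κ] [DecidableEq ι]
    [DecidableEq κ] (V : Matrix κ ι ℝ) {v α δ : ℝ} (hδ : |δ| ≤ 1)
    (hV : ∀ x, euclNorm (V *ᵥ x) ≤ v * euclNorm x) (x : κ ⊕ ι → ℝ) :
    euclNorm (fromBlocks (α • (1 : Matrix κ κ ℝ)) V 0 (δ • (1 : Matrix ι ι ℝ)) *ᵥ x) ≤
      √(α ^ 2 + 1 + v ^ 2) * euclNorm x := by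
  have hx := euclNorm_nonneg x
  refine euclNorm_le_of_sq_le (by positivity) ?_
  rw [mul_pow, Real.sq_sqrt (by positivity), fromBlocks_mulVec, euclNorm_sumElim_sq,
    euclNorm_eq_sumElim x]
  set y := x ∘ Sum.inl
  set z := x ∘ Sum.inr
  have hy := euclNorm_nonneg y
  have hz := euclNorm_nonneg z
  rw [zero_mulVec, zero_add, smul_mulVec, one_mulVec, smul_mulVec, one_mulVec, euclNorm_smul,
    mul_pow, sq_abs]
  have h1 : euclNorm (α • y + V *ᵥ z) ≤ |α| * euclNorm y + v * euclNorm z := by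
    refine (euclNorm_add_le _ _).trans (add_le_add (euclNorm_smul _ _).le (hV z))
  have h2 := pow_le_pow_left₀ (euclNorm_nonneg _) h1 2
  have h3 : δ ^ 2 ≤ 1 := by rwa [sq_le_one_iff_abs_le_one]
  have h4 : δ ^ 2 * euclNorm z ^ 2 ≤ euclNorm z ^ 2 := mul_le_of_le_one_left (sq_nonneg _) h3
  have h5 := sq_abs α
  nlinarith [sq_nonneg (v * euclNorm y - |α| * euclNorm z), sq_nonneg (euclNorm y)]

/-! ### Existence of pivots -/

section Existence

theorem exists_linearIndependent_submatrix_row {m n k : ℕ} (A : Matrix (Fin m) (Fin n) ℝ)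
    (hk : k ≤ A.rank) : ∃ r : Fin k ↪ Fin m, LinearIndependent ℝ (A.submatrix r id).row := by
  obtain ⟨κ, a, ha, hspan, hli⟩ := exists_linearIndependent' ℝ A.row
  have : Finite κ := Finite.of_injective a ha
  have := Fintype.ofFinite κ
  have hcard : A.rank = Fintype.card κ := by
    rw [A.rank_eq_finrank_span_row, ← hspan, finrank_span_eq_card hli]
  obtain ⟨e⟩ : Nonempty (Fin k ↪ κ) :=
    Function.Embedding.nonempty_of_card_le (by simpa [← hcard] using hk)
  exact ⟨e.trans ⟨a, ha⟩, hli.comp e e.injective⟩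

/-- A matrix of rank at least `k` has a nonsingular `k × k` submatrix. -/
theorem exists_det_submatrix_ne_zero {m n k : ℕ} (A : Matrix (Fin m) (Fin n) ℝ)
    (hk : k ≤ A.rank) :
    ∃ (r : Fin k ↪ Fin m) (c : Fin k ↪ Fin n), (A.submatrix r c).det ≠ 0 := by
  obtain ⟨r, hr⟩ := exists_linearIndependent_submatrix_row A hk
  have hrank : k ≤ (A.submatrix r id)ᵀ.rank := by
    rw [rank_transpose, hr.rank_matrix, Fintype.card_fin]
  obtain ⟨c, hc⟩ := exists_linearIndependent_submatrix_row _ hrank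
  refine ⟨r, c, ?_⟩
  have hu := (Matrix.linearIndependent_rows_iff_isUnit.mp hc)
  rw [Matrix.isUnit_iff_isUnit_det, isUnit_iff_ne_zero] at hu
  rwa [← Matrix.det_transpose]

theorem exists_equiv_extending {k m : ℕ} (r : Fin k ↪ Fin m) :
    ∃ e : Fin k ⊕ Fin (m - k) ≃ Fin m, ∀ i, e (Sum.inl i) = r i := by
  classical
  have hc : Fintype.card ↥(Set.range r)ᶜ = m - k := by
    rw [Fintype.card_compl_set, Fintype.card_fin, Set.card_range_of_injective r.injective,
      Fintype.card_fin]
  exact ⟨(Equiv.sumCongr (Equiv.ofInjective r r.injective)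
    (Fintype.equivFinOfCardEq hc).symm).trans (Equiv.Set.sumCompl (Set.range r)), fun i => rfl⟩

/-- A submatrix of globally maximal volume is in particular of locally maximal volume. -/
theorem exists_isLocalMaxVolumePivot {m n k : ℕ} (A : Matrix (Fin m) (Fin n) ℝ)
    (hk : k ≤ A.rank) : ∃ P : Pivoting m n k, P.IsLocalMaxVolumePivot A := by
  obtain ⟨r, c, hdet⟩ := exists_det_submatrix_ne_zero A hk
  have : Nonempty ((Fin k ↪ Fin m) × (Fin k ↪ Fin n)) := ⟨(r, c)⟩
  obtain ⟨⟨r₀, c₀⟩, hmax⟩ := Finite.exists_max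
    fun z : (Fin k ↪ Fin m) × (Fin k ↪ Fin n) => vol (A.submatrix z.1 z.2)
  obtain ⟨e, he⟩ := exists_equiv_extending r₀
  obtain ⟨f, hf⟩ := exists_equiv_extending c₀
  have hr : (⟨e, f⟩ : Pivoting m n k).pivotRows = r₀ := DFunLike.ext _ _ he
  have hc : (⟨e, f⟩ : Pivoting m n k).pivotCols = c₀ := DFunLike.ext _ _ hf
  refine ⟨⟨e, f⟩, ?_⟩
  rw [Pivoting.IsLocalMaxVolumePivot, hr, hc]
  refine ⟨lt_of_lt_of_le ?_ (hmax (r, c)), fun r' c' _ _ => hmax (r', c')⟩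
  rw [vol_eq_abs_det]
  exact abs_pos.mpr hdet

end Existence

/-! ### Singular values of the approximant and of the residual -/

namespace Pivoting

variable {m n k : ℕ} {P : Pivoting m n k} {A : Matrix (Fin m) (Fin n) ℝ}

/-- The block form of the approximant before undoing the permutations. -/
noncomputable def blockApprox (P : Pivoting m n k) (A : Matrix (Fin m) (Fin n) ℝ) :
    Matrix (Fin k ⊕ Fin (m - k)) (Fin k ⊕ Fin (n - k)) ℝ :=
  fromBlocks (P.A11 A) (P.A12 A) (P.A21 A) (P.A21 A * (P.A11 A)⁻¹ * P.A12 A)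

theorem sigma_permuted (P : Pivoting m n k) (A : Matrix (Fin m) (Fin n) ℝ) (j : ℕ) :
    sigma (P.permuted A) j = sigma A j := sigma_submatrix_equiv ..

theorem sigma_approx (P : Pivoting m n k) (A : Matrix (Fin m) (Fin n) ℝ) (j : ℕ) :
    sigma (P.approx A) j = sigma (P.blockApprox A) j := sigma_submatrix_equiv ..

theorem sub_approx_eq (P : Pivoting m n k) (A : Matrix (Fin m) (Fin n) ℝ) :
    A - P.approx A = (fromBlocks 0 0 0 (P.schur A)).submatrix P.row.symm P.col.symm := by
  have h : A = (P.permuted A).submatrix P.row.symm P.col.symm := by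
    simp [permuted]
  rw [permuted_eq_fromBlocks] at h
  have hS : fromBlocks 0 0 0 (P.schur A) =
      fromBlocks (P.A11 A) (P.A12 A) (P.A21 A) (P.A22 A) - P.blockApprox A := by
    rw [blockApprox, sub_eq_add_neg, fromBlocks_neg, fromBlocks_add]
    simp [schur, sub_eq_add_neg]
  rw [hS, submatrix_sub, Pi.sub_apply, Pi.sub_apply, ← h]
  rfl

theorem sigma_sub_approx_le (P : Pivoting m n k) (A : Matrix (Fin m) (Fin n) ℝ) (j : ℕ) :
    sigma (A - P.approx A) j ≤ sigma (P.schur A) j := by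
  rw [sub_approx_eq]
  refine (sigma_submatrix_equiv_le _ _ _ j).trans ?_
  have := sigma_le_of_dominated
    (fromBlocks 0 0 0 (P.schur A) : Matrix (Fin k ⊕ Fin (m - k)) (Fin k ⊕ Fin (n - k)) ℝ)
    (P.schur A)
    (LinearMap.funLeft ℝ ℝ (Sum.inr : Fin (n - k) → Fin k ⊕ Fin (n - k))) zero_le_one zero_le_one
    (fun x => by
      refine euclNorm_le_of_sq_le (by rw [one_mul]; exact euclNorm_nonneg _) ?_
      rw [fromBlocks_mulVec, euclNorm_sumElim_sq, one_mul]
      simp only [zero_mulVec, zero_add, euclNorm_zero]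
      rw [zero_pow two_ne_zero, zero_add]
      exact le_rfl)
    (fun x => by
      refine euclNorm_le_of_sq_le (by rw [one_mul]; exact euclNorm_nonneg _) ?_
      rw [one_mul, euclNorm_eq_sumElim x]
      exact le_add_of_nonneg_left (sq_nonneg _)) j
  simpa using this

theorem rank_approx_le (hdet : (P.A11 A).det ≠ 0) : (P.approx A).rank ≤ k := by
  have hu : IsUnit (P.A11 A).det := isUnit_iff_ne_zero.mpr hdet
  have h : P.blockApprox A =
      fromRows 1 (P.A21 A * (P.A11 A)⁻¹) * fromCols (P.A11 A) (P.A12 A) := by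
    rw [fromRows_mul_fromCols, blockApprox]
    simp [Matrix.mul_assoc, Matrix.nonsing_inv_mul _ hu]
  refine (rank_submatrix_le (P.blockApprox A) _ _).trans ?_
  rw [h]
  refine (rank_mul_le_right _ _).trans ((rank_le_card_height _).trans ?_)
  simp

theorem IsLocalMaxVolumePivot.euclNorm_A21_mul_inv_mulVec_le (h : P.IsLocalMaxVolumePivot A)
    (x : Fin k → ℝ) : euclNorm ((P.A21 A * (P.A11 A)⁻¹) *ᵥ x) ≤
      √(((m - k : ℕ) : ℝ) * k) * euclNorm x := by
  simpa using euclNorm_mulVec_le _ h.abs_A21_mul_inv_le_one zero_le_one x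

theorem IsLocalMaxVolumePivot.euclNorm_inv_mul_A12_mulVec_le (h : P.IsLocalMaxVolumePivot A)
    (x : Fin (n - k) → ℝ) : euclNorm (((P.A11 A)⁻¹ * P.A12 A) *ᵥ x) ≤
      √((k : ℝ) * ((n - k : ℕ) : ℝ)) * euclNorm x := by
  simpa using euclNorm_mulVec_le _ h.abs_inv_mul_A12_le_one zero_le_one x

/-- The approximant arises from `A` by multiplication with block triangular matrices:
`A_k = [I, 0; W, 0] A [I, V; 0, 0]` up to permutations. -/
theorem IsLocalMaxVolumePivot.sigma_approx_le (h : P.IsLocalMaxVolumePivot A) (j : ℕ) :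
    sigma (P.approx A) j ≤
      √(2 + ((m - k : ℕ) : ℝ) * k) * √(2 + (k : ℝ) * ((n - k : ℕ) : ℝ)) * sigma A j := by
  have hu : IsUnit (P.A11 A).det := isUnit_iff_ne_zero.mpr h.det_ne_zero
  have hfac : P.blockApprox A =
      fromBlocks ((1 : ℝ) • (1 : Matrix (Fin k) (Fin k) ℝ)) 0 (P.A21 A * (P.A11 A)⁻¹)
          ((0 : ℝ) • (1 : Matrix (Fin (m - k)) (Fin (m - k)) ℝ)) * P.permuted A *
        fromBlocks ((1 : ℝ) • (1 : Matrix (Fin k) (Fin k) ℝ)) ((P.A11 A)⁻¹ * P.A12 A) 0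
          ((0 : ℝ) • (1 : Matrix (Fin (n - k)) (Fin (n - k)) ℝ)) := by
    rw [permuted_eq_fromBlocks, fromBlocks_multiply, fromBlocks_multiply, blockApprox]
    simp [Matrix.mul_assoc, Matrix.nonsing_inv_mul _ hu, Matrix.mul_nonsing_inv_cancel_left _ _ hu]
  rw [sigma_approx, hfac, ← P.sigma_permuted A j]
  refine sigma_mul_mul_le _ _ _ (Real.sqrt_nonneg _) (Real.sqrt_nonneg _) (fun x => ?_)
    (fun x => ?_) j
  · refine (euclNorm_lowerBlock_mulVec_le _ (by simp)
      h.euclNorm_A21_mul_inv_mulVec_le x).trans_eq ?_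
    rw [Real.sq_sqrt (by positivity)]
    norm_num
  · refine (euclNorm_upperBlock_mulVec_le _ (by simp)
      h.euclNorm_inv_mul_A12_mulVec_le x).trans_eq ?_
    rw [Real.sq_sqrt (by positivity)]
    norm_num

/-- Weyl's inequality, together with the fact that the norm of the Schur complement is controlled by
`σ_k(A_k)`. -/
theorem IsLocalMaxVolumePivot.sigma_le_sigma_approx (h : P.IsLocalMaxVolumePivot A) {j : ℕ}
    (hj : 1 ≤ j) (hjk : j ≤ k) :
    sigma A j ≤ (1 + 2 * k * √(((m - k : ℕ) : ℝ) * ((n - k : ℕ) : ℝ))) *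
      sigma (P.approx A) j := by
  obtain ⟨s, hs, hS, hM⟩ := h.exists_schur_bound
  have hk : (0 : ℝ) < 2 * k := by
    have : (0 : ℝ) < k := by exact_mod_cast (by omega : 0 < k)
    positivity
  have h1 : sigma (P.schur A) 1 ≤ s * √(((m - k : ℕ) : ℝ) * ((n - k : ℕ) : ℝ)) :=
    sigma_le_of_forall_euclNorm_mulVec_le _ (by positivity) (fun x => by
      simpa only [Fintype.card_fin] using euclNorm_mulVec_le _ hS hs x) 1
  have h2 : s / (2 * k) ≤ sigma (P.approx A) k := by
    rw [sigma_approx]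
    let g : (Fin k → ℝ) →ₗ[ℝ] (Fin k ⊕ Fin (n - k) → ℝ) :=
      { toFun := fun x => Sum.elim x 0
        map_add' := fun x y => by ext (i | i) <;> simp
        map_smul' := fun c x => by ext (i | i) <;> simp }
    have hg : Function.Injective g := fun x y hxy => by
      ext i
      exact congrFun hxy (Sum.inl i)
    refine le_sigma_of_le_euclNorm_mulVec _ (hj.trans hjk) (by simp) g hg fun x => ?_
    have hgx : euclNorm (g x) = euclNorm x := by
      rw [← sq_eq_sq₀ (euclNorm_nonneg _) (euclNorm_nonneg _)]
      change euclNorm (Sum.elim x 0) ^ 2 = _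
      rw [euclNorm_sumElim_sq, euclNorm_zero]
      ring
    rw [hgx, div_mul_eq_mul_div, div_le_iff₀ hk, mul_comm _ (2 * (k : ℝ))]
    refine (hM x).trans (mul_le_mul_of_nonneg_left ?_ hk.le)
    refine euclNorm_le_of_sq_le (euclNorm_nonneg _) ?_
    change _ ≤ euclNorm (P.blockApprox A *ᵥ Sum.elim x 0) ^ 2
    rw [blockApprox, fromBlocks_mulVec, euclNorm_sumElim_sq]
    simp only [Sum.elim_comp_inl, Sum.elim_comp_inr, mulVec_zero, add_zero]
    exact le_add_of_nonneg_right (sq_nonneg _)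
  have h3 : sigma A j ≤ sigma (A - P.approx A) 1 + sigma (P.approx A) j := by
    simpa using sigma_add_le (A - P.approx A) (P.approx A) hj 0
  have h4 : s ≤ 2 * k * sigma (P.approx A) j := by
    rw [div_le_iff₀' hk] at h2
    exact h2.trans (mul_le_mul_of_nonneg_left (sigma_antitone _ hjk) hk.le)
  have h5 := mul_le_mul_of_nonneg_right h4
    (Real.sqrt_nonneg (((m - k : ℕ) : ℝ) * ((n - k : ℕ) : ℝ)))
  have h6 := P.sigma_sub_approx_le A 1
  linarith

theorem sigma_add_le_sigma_sub_approx (hdet : (P.A11 A).det ≠ 0) {j : ℕ} (hj : 1 ≤ j) :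
    sigma A (k + j) ≤ sigma (A - P.approx A) j := by
  have h := sigma_add_le (P.approx A) (A - P.approx A) hj k
  rwa [add_sub_cancel, (sigma_eq_zero_iff_rank_lt _ (by omega)).mpr
    (Nat.lt_succ_of_le (rank_approx_le hdet)), zero_add] at h

/-- Block elimination turns `A` into `diag(A₁₁, S)`. Rescaling the pivot rows by `α` and the pivot
columns by `β` with `αβ = 2k√((m-k)(n-k))` makes the first block at least as large as all
of `S`, so that `σ_j(S)` is below the singular value number `k + j` of the block diagonal matrix;
choosing `α` and `β` comparable to the norms of the left and the right eliminating factor keeps the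
resulting bound of the order `k √(mn)`. -/
theorem IsLocalMaxVolumePivot.sigma_sub_approx_le (h : P.IsLocalMaxVolumePivot A) {j : ℕ}
    (hj : 1 ≤ j) :
    sigma (A - P.approx A) j ≤
      √(1 + 3 * (k : ℝ) * ((m - k : ℕ) : ℝ)) * √(1 + 3 * (k : ℝ) * ((n - k : ℕ) : ℝ)) *
        sigma A (k + j) := by
  refine (P.sigma_sub_approx_le A j).trans ?_
  have hA := sigma_nonneg A (k + j)
  rcases lt_or_ge (Fintype.card (Fin (n - k))) j with hjn | hjn
  · rw [sigma_eq_zero_of_card_lt _ hjn]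
    positivity
  obtain ⟨s, hs, hS, hM⟩ := h.exists_schur_bound
  obtain ⟨g, hg, hgS⟩ := exists_sigma_le_euclNorm_mulVec (P.schur A) hj hjn
  set t := sigma (P.schur A) j with ht
  have ht0 : 0 ≤ t := sigma_nonneg _ _
  set a : ℝ := ((m - k : ℕ) : ℝ) with ha
  set b : ℝ := ((n - k : ℕ) : ℝ) with hb
  have hts : t ≤ s * √(a * b) :=
    sigma_le_of_forall_euclNorm_mulVec_le _ (by positivity) (fun x => by
      simpa only [Fintype.card_fin] using euclNorm_mulVec_le _ hS hs x) j
  set α := √(2 * k * a) with hα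
  set β := √(2 * k * b) with hβ
  have hαβ : α * β = 2 * k * √(a * b) := by
    rw [hα, hβ, ← Real.sqrt_mul (by positivity),
      show 2 * (k : ℝ) * a * (2 * k * b) = (2 * k) ^ 2 * (a * b) by ring,
      Real.sqrt_mul (by positivity), Real.sqrt_sq (by positivity)]
  have hu : IsUnit (P.A11 A).det := isUnit_iff_ne_zero.mpr h.det_ne_zero
  have hfac : fromBlocks (α • (1 : Matrix (Fin k) (Fin k) ℝ)) 0 (-(P.A21 A * (P.A11 A)⁻¹))
          ((1 : ℝ) • (1 : Matrix (Fin (m - k)) (Fin (m - k)) ℝ)) * P.permuted A *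
        fromBlocks (β • (1 : Matrix (Fin k) (Fin k) ℝ)) (-((P.A11 A)⁻¹ * P.A12 A)) 0
          ((1 : ℝ) • (1 : Matrix (Fin (n - k)) (Fin (n - k)) ℝ)) =
      fromBlocks ((α * β) • P.A11 A) 0 0 (P.schur A) := by
    rw [permuted_eq_fromBlocks, fromBlocks_multiply, fromBlocks_multiply]
    simp [Matrix.mul_assoc, Matrix.nonsing_inv_mul _ hu, Matrix.mul_nonsing_inv_cancel_left _ _ hu,
      schur, smul_smul, mul_comm, sub_eq_add_neg, add_comm]
  have hD : sigma (fromBlocks ((α * β) • P.A11 A) 0 0 (P.schur A)) (k + j) ≤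
      √(1 + 3 * k * a) * √(1 + 3 * k * b) * sigma A (k + j) := by
    rw [← hfac, ← P.sigma_permuted A]
    refine sigma_mul_mul_le _ _ _ (Real.sqrt_nonneg _) (Real.sqrt_nonneg _) (fun x => ?_)
      (fun x => ?_) _
    · refine (euclNorm_lowerBlock_mulVec_le _ (w := √(a * k)) (by simp)
        (fun y => ?_) x).trans_eq ?_
      · rw [neg_mulVec, euclNorm_neg]
        exact h.euclNorm_A21_mul_inv_mulVec_le y
      · rw [Real.sq_sqrt (by positivity), Real.sq_sqrt (by positivity)]
        ring_nf
    · refine (euclNorm_upperBlock_mulVec_le _ (v := √(k * b)) (by simp)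
        (fun y => ?_) x).trans_eq ?_
      · rw [neg_mulVec, euclNorm_neg]
        exact h.euclNorm_inv_mul_A12_mulVec_le y
      · rw [Real.sq_sqrt (by positivity), Real.sq_sqrt (by positivity)]
        ring_nf
  refine le_trans ?_ hD
  let G : ((Fin k → ℝ) × (Fin j → ℝ)) →ₗ[ℝ] (Fin k ⊕ Fin (n - k) → ℝ) :=
    { toFun := fun z => Sum.elim z.1 (g z.2)
      map_add' := fun x y => by ext (i | i) <;> simp
      map_smul' := fun c x => by ext (i | i) <;> simp }
  have hG : Function.Injective G := fun x y hxy => by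
    refine Prod.ext (funext fun i => congrFun hxy (Sum.inl i)) (hg (funext fun i => ?_))
    exact congrFun hxy (Sum.inr i)
  refine le_sigma_of_le_euclNorm_mulVec _ (by omega) (by simp) G hG fun z => ?_
  refine le_of_sq_le_sq ?_ (euclNorm_nonneg _)
  change (t * euclNorm (Sum.elim z.1 (g z.2))) ^ 2 ≤ euclNorm (_ *ᵥ Sum.elim z.1 (g z.2)) ^ 2
  rw [fromBlocks_mulVec, euclNorm_sumElim_sq, mul_pow, euclNorm_sumElim_sq, mul_add,
    ← mul_pow, ← mul_pow]
  simp only [Sum.elim_comp_inl, Sum.elim_comp_inr, zero_mulVec, add_zero, zero_add]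
  have hz1 := euclNorm_nonneg z.1
  have hz2 := euclNorm_nonneg (g z.2)
  refine add_le_add (pow_le_pow_left₀ (by positivity) ?_ 2)
    (pow_le_pow_left₀ (by positivity) (hgS _) 2)
  rw [smul_mulVec, euclNorm_smul, hαβ, abs_of_nonneg (by positivity)]
  calc t * euclNorm z.1 ≤ s * √(a * b) * euclNorm z.1 := by gcongr
    _ = √(a * b) * (s * euclNorm z.1) := by ring
    _ ≤ √(a * b) * (2 * k * euclNorm (P.A11 A *ᵥ z.1)) :=
        mul_le_mul_of_nonneg_left (hM _) (Real.sqrt_nonneg _)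
    _ = _ := by ring

end Pivoting

/-- If the pivot has size `rank A`, elimination reproduces `A`: the singular values of the residual
are bounded by singular values of `A` beyond its rank. -/
theorem Pivoting.IsLocalMaxVolumePivot.approx_eq_of_rank {m n : ℕ} {A : Matrix (Fin m) (Fin n) ℝ}
    {P : Pivoting m n A.rank} (h : P.IsLocalMaxVolumePivot A) : P.approx A = A := by
  have h1 := h.sigma_sub_approx_le le_rfl
  rw [(sigma_eq_zero_iff_rank_lt A (by omega)).mpr (Nat.lt_succ_self _), mul_zero] at h1
  have h2 := (sigma_eq_zero_iff_rank_lt _ le_rfl).mp (le_antisymm h1 (sigma_nonneg _ _))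
  rw [Nat.lt_one_iff, Matrix.rank, Submodule.finrank_eq_zero, LinearMap.range_eq_bot] at h2
  have h3 : A - P.approx A = 0 := mulVec_injective (funext fun x => by
    rw [zero_mulVec]
    exact LinearMap.congr_fun h2 x)
  exact (sub_eq_zero.mp h3).symm

/-! ### Rank-revealing property -/

theorem sqrt_mul_sqrt_le_factor {m n k a b c : ℝ} (hc : c ≤ 5) (hc0 : 0 ≤ c) (hk : 0 ≤ k)
    (hm : 0 ≤ m) (ha : a ≤ c * (k * m)) (hb : b ≤ c * (k * n)) :
    √a * √b ≤ 1 + 5 * k * √(m * n) := by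
  have h : √a * √b ≤ c * k * √(m * n) := by
    calc √a * √b ≤ √(c * (k * m)) * √(c * (k * n)) := by gcongr
      _ = √((c * k) ^ 2 * (m * n)) := by
          rw [← Real.sqrt_mul (by positivity)]
          ring_nf
      _ = c * k * √(m * n) := by
          rw [Real.sqrt_mul (by positivity), Real.sqrt_sq (by positivity)]
  have : c * k * √(m * n) ≤ 5 * k * √(m * n) := by gcongr
  linarith

theorem one_le_factor (m n k : ℕ) : (1 : ℝ) ≤ 1 + 5 * (k : ℝ) * √((m : ℝ) * n) := by
  have : (0 : ℝ) ≤ 5 * (k : ℝ) * √((m : ℝ) * n) := by positivity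
  linarith

theorem geLocalMaxVolume_leading {m n k : ℕ} {A B : Matrix (Fin m) (Fin n) ℝ}
    (hk : k ≤ min m n) (hB : geLocalMaxVolume m n A k B) {j : ℕ} (hj : 1 ≤ j) (hjk : j ≤ k) :
    sigma A j ≤ (1 + 5 * (k : ℝ) * √((m : ℝ) * n)) * sigma B j ∧
      sigma B j ≤ (1 + 5 * (k : ℝ) * √((m : ℝ) * n)) * sigma A j := by
  obtain ⟨r, P, (rfl | ⟨rfl, hr⟩), hP, rfl⟩ := hB
  · have hA := sigma_nonneg A j
    have hB := sigma_nonneg (P.approx A) j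
    have hr1 : (1 : ℝ) ≤ r := by exact_mod_cast hj.trans hjk
    have hrm : r ≤ m := hk.trans (min_le_left _ _)
    have hrn : r ≤ n := hk.trans (min_le_right _ _)
    refine ⟨(hP.sigma_le_sigma_approx hj hjk).trans ?_, (hP.sigma_approx_le j).trans ?_⟩
    · have hmr : ((m - r : ℕ) : ℝ) ≤ m := by exact_mod_cast Nat.sub_le _ _
      have hnr : ((n - r : ℕ) : ℝ) ≤ n := by exact_mod_cast Nat.sub_le _ _
      gcongr
      norm_num
    · -- Since `r ≥ 1`, `2 + (m - r) r ≤ 2 r m`, and likewise for `n`.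
      have hrm' : (r : ℝ) ≤ m := by exact_mod_cast hrm
      have hrn' : (r : ℝ) ≤ n := by exact_mod_cast hrn
      refine mul_le_mul_of_nonneg_right (sqrt_mul_sqrt_le_factor (c := 2) (by norm_num)
        (by norm_num) (by positivity) (by positivity) ?_ ?_) hA
      · rw [Nat.cast_sub hrm]
        nlinarith
      · rw [Nat.cast_sub hrn]
        nlinarith
  · rw [hP.approx_eq_of_rank]
    have := le_mul_of_one_le_left (sigma_nonneg A j) (one_le_factor m n k)
    exact ⟨this, this⟩

theorem geLocalMaxVolume_trailing {m n k : ℕ} {A B : Matrix (Fin m) (Fin n) ℝ}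
    (hk1 : 1 ≤ k) (hB : geLocalMaxVolume m n A k B) {j : ℕ}
    (hj : 1 ≤ j) (hjk : j ≤ min m n - k) :
    sigma A (k + j) ≤ (1 + 5 * (k : ℝ) * √((m : ℝ) * n)) * sigma (A - B) j ∧
      sigma (A - B) j ≤ (1 + 5 * (k : ℝ) * √((m : ℝ) * n)) * sigma A (k + j) := by
  obtain ⟨r, P, (rfl | ⟨rfl, hr⟩), hP, rfl⟩ := hB
  · have hA := sigma_nonneg A (r + j)
    have hr1 : (1 : ℝ) ≤ r := by exact_mod_cast hk1
    refine ⟨(Pivoting.sigma_add_le_sigma_sub_approx hP.det_ne_zero hj).trans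
      (le_mul_of_one_le_left (sigma_nonneg _ _) (one_le_factor m n r)),
      (hP.sigma_sub_approx_le hj).trans ?_⟩
    -- Since `r ≥ 1`, `1 + 3 r (m - r) ≤ 3 r m`, and likewise for `n`.
    refine mul_le_mul_of_nonneg_right (sqrt_mul_sqrt_le_factor (c := 3) (by norm_num)
        (by norm_num) (by positivity) (by positivity) ?_ ?_) hA
    · rw [Nat.cast_sub (by omega)]
      nlinarith
    · rw [Nat.cast_sub (by omega)]
      nlinarith
  · rw [hP.approx_eq_of_rank, sub_self,
      (sigma_eq_zero_iff_rank_lt A (by omega)).mpr (by omega),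
      (sigma_eq_zero_iff_rank_lt 0 hj).mpr (by rw [Matrix.rank_zero]; omega)]
    simp

theorem isRankRevealer_geLocalMaxVolume :
    IsRankRevealer geLocalMaxVolume
      (fun m n k : ℕ => 1 + 5 * (k : ℝ) * Real.sqrt ((m : ℝ) * (n : ℝ))) where
  poly_bounded := by
    -- `√(mn) ≤ mn` for natural numbers `m` and `n`.
    refine ⟨1 + 5 * MvPolynomial.X 2 * (MvPolynomial.X 0 * MvPolynomial.X 1), fun m n k _ _ => ?_⟩
    have h : √((m : ℝ) * n) ≤ m * n := by
      rw [Real.sqrt_le_left (by positivity)]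
      exact_mod_cast Nat.le_self_pow two_ne_zero (m * n)
    have : 5 * (k : ℝ) * √((m : ℝ) * n) ≤ 5 * k * (m * n) := by gcongr
    simpa [MvPolynomial.eval_ofNat] using this
  one_le m n k _ _ := one_le_factor m n k
  exists_output m n A k _ _ := by
    rcases le_or_gt k A.rank with hk | hk
    · obtain ⟨P, hP⟩ := exists_isLocalMaxVolumePivot A hk
      exact ⟨_, k, P, Or.inl rfl, hP, rfl⟩
    · obtain ⟨P, hP⟩ := exists_isLocalMaxVolumePivot A le_rfl
      exact ⟨_, A.rank, P, Or.inr ⟨rfl, hk⟩, hP, rfl⟩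
  rank_le m n A k _ _ B hB := by
    obtain ⟨r, P, hr, hP, rfl⟩ := hB
    exact (Pivoting.rank_approx_le hP.det_ne_zero).trans (by omega)
  leading m n A k _ hk B hB j hj hjk := by
    obtain ⟨h1, h2⟩ := geLocalMaxVolume_leading hk hB hj hjk
    have := zero_lt_one.trans_le (one_le_factor m n k)
    exact ⟨by rwa [one_div_mul_eq_div, div_le_iff₀' this], h2⟩
  trailing m n A k hk1 _ B hB j hj hjk := by
    obtain ⟨h1, h2⟩ := geLocalMaxVolume_trailing hk1 hB hj hjk
    have := zero_lt_one.trans_le (one_le_factor m n k)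
    exact ⟨by rwa [one_div_mul_eq_div, div_le_iff₀' this], h2⟩

end RankRevealing

theorem mainTheorem1 :
    RankRevealing.IsRankRevealer RankRevealing.geLocalMaxVolume
      (fun m n k : ℕ => 1 + 5 * (k : ℝ) * Real.sqrt ((m : ℝ) * (n : ℝ))) ∧
    ∀ (m n k : ℕ) (A : Matrix (Fin m) (Fin n) ℝ) (P : RankRevealing.Pivoting m n k),
      P.IsLocalMaxVolumePivot A →
        P.permuted A = P.lower A * P.upper A ∧
        ∃ ν : ℝ, 0 ≤ ν ∧ ν ≤ 1 ∧ P.InterpolativeBounds A ν :=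
  ⟨RankRevealing.isRankRevealer_geLocalMaxVolume, fun _ _ _ _ _ hP =>
    ⟨RankRevealing.Pivoting.permuted_eq_lower_mul_upper hP.det_ne_zero, 1, zero_le_one, le_rfl,
      hP.interpolativeBounds⟩⟩
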